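/- Consider an asynchronous shared-memory system of $n$ deterministic processes with distinct identifiers, in which processes may fail only by crashing. The processes communicate (1) by atomically reading and writing shared multi-writer multi-reader registers and (2) through wait-free full agreement (consensus) objects for $t$ processes: such an object may be accessed by at most $t$ different processes, and every process that proposes a value to it receives as response one and the same value, namely the first value proposed to it. Algorithms may use arbitrarily many registers and objects. Each process has an input (its proposed value) from a given set of $m$ possible input values, and may irrevocably decide on a value and terminate. An algorithm is an \emph{$(n,k)$-partial agreement algorithm that tolerates $t$ crash failures} if, for every assignment of inputs, in every execution there is a value $v$ such that - (agreement) at most $n-k$ processes decide on values other than $v$ (so that when all $n$ processes decide, at least $k$ of them decide on $v$; for $k>n$ the requirement cannot be met); - (weak validity) $v$ is the input of at least one process; and - ($t$-resiliency) if at most $t$ processes crash in the execution, then every process that does not crash eventually decides and terminates. In the variant with \emph{strong validity}, weak validity is replaced by the requirement that every decided value is the input of some process. Theorem. Let $n, m, t, k$ be integers with $n\ge 2$, $m\ge 2$, $n>t\ge 1$ and $k\ge 0$. Under either of the two validity requirements, if there exists an $(n,k)$-partial agreement algorithm for $m$ possible input values that tolerates $t$ crash failures and uses atomic registers and wait-free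 full agreement objects for $t$ processes, then $$k\le \left\lceil \frac{n+t-1}{2}\right\rceil .$$ -/

import Mathlib

/-!
Asynchronous shared memory systems whose `n` deterministic, crash-prone processes communicate
through atomic read/write registers and atomic full agreement (consensus) objects, and the
`(n, k)`-partial agreement problem in such systems.
-/

universe u v

namespace PartialAgreement

/-- What a process does next in a given local state: one atomic operation on a shared object,
together with the local state reached once the response is known, or a final decision. -/
inductive Action (V : Type u) (State Reg RegVal Obj ObjVal : Type v) : Type (max u v)
  /-- Atomically read the register `r`. -/
  | read (r : Reg) (next : RegVal → State)
  /-- Atomically write `a` to the register `r`. -/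
  | write (r : Reg) (a : RegVal) (next : State)
  /-- Propose `a` to the agreement object `o`; the response is the value decided by `o`. -/
  | propose (o : Obj) (a : ObjVal) (next : ObjVal → State)
  /-- Decide on `d` and terminate. -/
  | decide (d : V)

/-- A deterministic algorithm for `n` processes with input and decision values in `V`. It may use
any number of multi-writer multi-reader registers (indexed by `Reg`) and of agreement objects
(indexed by `Obj`). The code of a process may depend on its identifier. -/
structure Algorithm (n : ℕ) (V : Type u) where
  /-- local states of the processes -/
  State : Type v
  /-- names of the registers -/
  Reg : Type v
  /-- values the registers can hold -/
  RegVal : Type v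
  /-- names of the agreement objects -/
  Obj : Type v
  /-- values that can be proposed to the agreement objects -/
  ObjVal : Type v
  /-- initial local state of a process with a given input -/
  start : Fin n → V → State
  /-- initial values of the registers -/
  regStart : Reg → RegVal
  /-- the code of the processes -/
  action : Fin n → State → Action V State Reg RegVal Obj ObjVal

namespace Algorithm

variable {n : ℕ} {V : Type u}

/-- A configuration: the local states, the contents of the registers, and for each agreement
object the value it has decided on (`none` as long as nothing was proposed to it). -/
@[ext] structure Config (A : Algorithm.{u, v} n V) where
  loc : Fin n → A.State
  reg : A.Reg → A.RegVal
  obj : A.Obj → Option A.ObjVal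

/-- The initial configuration for the inputs `x`. -/
def initial (A : Algorithm.{u, v} n V) (x : Fin n → V) : A.Config where
  loc p := A.start p (x p)
  reg := A.regStart
  obj _ := none

open Classical in
/-- The configuration after one atomic step of process `p`. An agreement object decides on the
first value proposed to it and returns that value to every proposer. A process that has decided
has terminated: its steps have no effect. -/
noncomputable def step (A : Algorithm.{u, v} n V) (c : A.Config) (p : Fin n) : A.Config :=
  match A.action p (c.loc p) with
  | .read r next => { c with loc := Function.update c.loc p (next (c.reg r)) }
  | .write r a next =>
      { c with loc := Function.update c.loc p next, reg := Function.update c.reg r a }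
  | .propose o a next =>
      { c with
        loc := Function.update c.loc p (next ((c.obj o).getD a))
        obj := Function.update c.obj o (some ((c.obj o).getD a)) }
  | .decide _ => c

/-- The run on inputs `x` in which process `σ i` takes the `i`-th step: its configuration after
`i` steps. There is no restriction on the schedule `σ`, so the system is asynchronous. -/
noncomputable def run (A : Algorithm.{u, v} n V) (x : Fin n → V) (σ : ℕ → Fin n) : ℕ → A.Config
  | 0 => A.initial x
  | i + 1 => A.step (A.run x σ i) (σ i)

/-- In the run on inputs `x` with schedule `σ`, process `p` decides on the value `d`. -/
def Decides (A : Algorithm.{u, v} n V) (x : Fin n → V) (σ : ℕ → Fin n) (p : Fin n) (d : V) :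
    Prop :=
  ∃ i, A.action p ((A.run x σ i).loc p) = .decide d

/-- In the run on inputs `x` with schedule `σ`, process `p` proposes some value to the agreement
object `o`. -/
def Accesses (A : Algorithm.{u, v} n V) (x : Fin n → V) (σ : ℕ → Fin n) (p : Fin n)
    (o : A.Obj) : Prop :=
  ∃ i, σ i = p ∧ ∃ a next, A.action p ((A.run x σ i).loc p) = .propose o a next

/-- All agreement objects are used as objects for `g` processes: for inputs from `I`, in every
run, each agreement object is accessed by at most `g` different processes (which need not be the
same ones in different runs). -/
def UsesObjectsFor (A : Algorithm.{u, v} n V) (I : Finset V) (g : ℕ) : Prop :=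
  ∀ x : Fin n → V, (∀ p, x p ∈ I) → ∀ σ : ℕ → Fin n, ∀ o : A.Obj,
    {p | A.Accesses x σ p o}.ncard ≤ g

end Algorithm

/-- A process crashes in a run if it takes only finitely many steps. (Processes that have decided
can go on taking steps without effect, so they are not forced to count as crashed.) -/
def Crashes {n : ℕ} (σ : ℕ → Fin n) (p : Fin n) : Prop :=
  ∃ N, ∀ i, N ≤ i → σ i ≠ p

/-- The two validity requirements. -/
inductive Validity
  /-- the common decision value is the input of some process -/
  | weak
  /-- every decided value is the input of some process -/
  | strong

namespace Algorithm

variable {n : ℕ} {V : Type u}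

/-- Agreement and validity in the run on inputs `x` with schedule `σ`: there is a decision value
`d` such that at most `n - k` processes decide on values other than `d` (hence none of this is
possible when `k > n`), and the validity requirement holds. -/
def Agrees (A : Algorithm.{u, v} n V) (val : Validity) (k : ℕ) (x : Fin n → V)
    (σ : ℕ → Fin n) : Prop :=
  ∃ d : V, {p | ∃ e, e ≠ d ∧ A.Decides x σ p e}.ncard + k ≤ n ∧
    match val with
    | .weak => ∃ q, x q = d
    | .strong => ∀ p e, A.Decides x σ p e → ∃ q, x q = e

/-- `A` is an `(n, k)`-partial agreement algorithm for inputs from `I` that tolerates `t` crash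
failures: every run satisfies agreement and validity, and in every run with at most `t` crashes
each process that does not crash eventually decides. -/
def SolvesPartialAgreement (A : Algorithm.{u, v} n V) (val : Validity) (I : Finset V)
    (k t : ℕ) : Prop :=
  ∀ x : Fin n → V, (∀ p, x p ∈ I) → ∀ σ : ℕ → Fin n,
    A.Agrees val k x σ ∧
    ({p | Crashes σ p}.ncard ≤ t → ∀ p, ¬ Crashes σ p → ∃ d, A.Decides x σ p d)

end Algorithm

end PartialAgreement

/-!
The proof is a bivalency argument in the style of Fischer, Lynch and Paterson. Suppose
`2 k > n + t`. A value is *committed* once more than `n - k` processes have decided on it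
(`Algorithm.Commits`). In one execution at most one value is committed, and it is an input. If at
most `t` processes are halted, the others eventually commit to a value all by themselves
(`Algorithm.exists_commits`): at least `n - t` of them decide, at most `n - k` on a value other than
the common one, and `(n - t) - (n - k) > n - k`. Hence two configurations that differ only in the
local states of at most `t` processes have a possible committed value in common
(`Algorithm.exists_possible_of_similar`).

The same holds if the configurations also differ in the state of an agreement object `o`, provided
that the processes whose local states differ have all been about to access `o`
(`Algorithm.exists_possible_of_similar_of_poised`). Every process about to access `o` can be made to
access it in one and the same run, so there are at most `t` of them; when they are all halted, the
others commit to a value without noticing the difference. It is here that the number of processes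
served by an object matches the number of tolerated crashes.

With inputs from two values there is a bivalent initial configuration, one from which two values can
still be committed (`Algorithm.exists_bivalent_initial`). A fair schedule cannot preserve bivalence
forever, so some bivalent configuration is critical (`Algorithm.exists_critical`), and near it there
are steps of `p` and of `q` followed by `p`, from the same configuration, after which no common value
is possible (`Algorithm.exists_fork`). But two steps either commute, or their order is noticed by a
single process only, or both are proposals to the same object (`Algorithm.step_interaction`), and in
each case the two outcomes share a possible value (`Algorithm.exists_possible_step_step`).
-/

namespace PartialAgreement

/-! ### Fair schedules -/

/-- A property of finite schedules that can always be preserved while scheduling any prescribed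
element of `T` once more holds for arbitrarily long prefixes of some infinite schedule in which
every element of `T` occurs infinitely often. -/
theorem exists_fair_schedule {α : Type*} {T : Set α} (hT : T.Countable) (hne : T.Nonempty)
    (P : List α → Prop) (w₀ : List α) (h₀ : P w₀)
    (hP : ∀ w, P w → ∀ p ∈ T, ∃ u, P (w ++ u ++ [p])) :
    ∃ σ : ℕ → α, (∀ p ∈ T, ∀ N, ∃ i, N ≤ i ∧ σ i = p) ∧
      (∀ N, ∃ M, N ≤ M ∧ P ((List.range M).map σ)) ∧
      (List.range w₀.length).map σ = w₀ := by
  obtain ⟨e, rfl⟩ := hT.exists_eq_range hne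
  have hP' : ∀ w : {w // P w}, ∀ k : ℕ, ∃ u, P (w.1 ++ u ++ [e k]) :=
    fun w k => hP w.1 w.2 _ ⟨k, rfl⟩
  choose ext hext using hP'
  let W : ℕ → {w // P w} := fun k =>
    Nat.rec ⟨w₀, h₀⟩ (fun j w => ⟨w.1 ++ ext w j.unpair.1 ++ [e j.unpair.1], hext w _⟩) k
  have hsucc : ∀ j, (W (j + 1)).1 = (W j).1 ++ ext (W j) j.unpair.1 ++ [e j.unpair.1] :=
    fun j => rfl
  have hpre : ∀ j l, j ≤ l → (W j).1 <+: (W l).1 := by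
    intro j l hjl
    induction hjl with
    | refl => exact List.prefix_rfl
    | step _ ih =>
      refine ih.trans ?_
      rw [hsucc, List.append_assoc]
      exact List.prefix_append _ _
  have hlen : ∀ j, j ≤ (W j).1.length := by
    intro j
    induction j with
    | zero => exact Nat.zero_le _
    | succ j ih =>
      rw [hsucc]
      simp only [List.length_append, List.length_singleton]
      omega
  let σ : ℕ → α := fun i => (W (i + 1)).1[i]'(hlen (i + 1))
  have hσ : ∀ j i (hi : i < (W j).1.length), σ i = (W j).1[i] := by
    intro j i hi
    rcases le_total j (i + 1) with h | h
    · exact ((hpre _ _ h).getElem hi).symm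
    · exact (hpre _ _ h).getElem (hlen (i + 1))
  have hmap : ∀ j, (List.range (W j).1.length).map σ = (W j).1 := by
    intro j
    refine List.ext_getElem (by simp) fun i h₁ h₂ => ?_
    simp only [List.getElem_map, List.getElem_range]
    exact hσ j i h₂
  refine ⟨σ, ?_, fun N => ⟨_, hlen N, by rw [hmap]; exact (W N).2⟩, hmap 0⟩
  rintro _ ⟨k, rfl⟩ N
  have hj : (Nat.pair k N).unpair.1 = k := by simp
  have hN : N ≤ Nat.pair k N := Nat.right_le_pair _ _
  generalize Nat.pair k N = j at hj hN
  refine ⟨((W j).1 ++ ext (W j) j.unpair.1).length, ?_, ?_⟩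
  · have := hlen j
    simp only [List.length_append]
    omega
  · rw [hσ (j + 1) _ (by rw [hsucc, List.length_append (bs := [_])]; simp)]
    simp [hsucc, hj]

/-- Every finite schedule extends to one in which every process takes infinitely many steps. -/
theorem exists_fair_extension {n : ℕ} (hn : 0 < n) (w : List (Fin n)) :
    ∃ σ : ℕ → Fin n, (∀ p N, ∃ i, N ≤ i ∧ σ i = p) ∧ (List.range w.length).map σ = w := by
  obtain ⟨σ, h, -, hw⟩ := exists_fair_schedule (T := (Set.univ : Set (Fin n)))
    (Set.to_countable _) ⟨⟨0, hn⟩, trivial⟩ (fun _ => True) w trivial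
    (fun _ _ _ _ => ⟨[], trivial⟩)
  exact ⟨σ, fun p => h p trivial, hw⟩

namespace Algorithm

variable {n : ℕ} {V : Type u} {A : Algorithm.{u, v} n V}

/-! ### Finite executions -/

/-- The configuration reached from `c` when the processes listed in `w` take one step each, in
this order. -/
noncomputable def exec (A : Algorithm.{u, v} n V) (c : A.Config) (w : List (Fin n)) : A.Config :=
  w.foldl A.step c

@[simp] theorem exec_nil (c : A.Config) : A.exec c [] = c := rfl

@[simp] theorem exec_cons (c : A.Config) (p : Fin n) (w : List (Fin n)) :
    A.exec c (p :: w) = A.exec (A.step c p) w := rfl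

@[simp] theorem exec_append (c : A.Config) (w w' : List (Fin n)) :
    A.exec c (w ++ w') = A.exec (A.exec c w) w' := List.foldl_append

theorem run_eq_exec (x : Fin n → V) (σ : ℕ → Fin n) (i : ℕ) :
    A.run x σ i = A.exec (A.initial x) ((List.range i).map σ) := by
  induction i with
  | zero => rfl
  | succ i ih => rw [run, ih, List.range_succ, List.map_append, exec_append]; rfl

/-- In the configuration `c`, process `p` has decided on `d`. -/
def HasDecided (A : Algorithm.{u, v} n V) (c : A.Config) (p : Fin n) (d : V) : Prop :=
  A.action p (c.loc p) = .decide d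

/-- In the configuration `c`, the next step of process `p` is a proposal to the object `o`. -/
def Poised (A : Algorithm.{u, v} n V) (c : A.Config) (p : Fin n) (o : A.Obj) : Prop :=
  ∃ a next, A.action p (c.loc p) = .propose o a next

theorem loc_step_of_ne (c : A.Config) {p q : Fin n} (h : p ≠ q) :
    (A.step c q).loc p = c.loc p := by
  unfold step
  split <;> simp [h]

theorem HasDecided.step_eq {c : A.Config} {p : Fin n} {d : V} (h : A.HasDecided c p d) :
    A.step c p = c := by
  unfold HasDecided at h
  unfold step
  rw [h]

theorem HasDecided.exec {c : A.Config} {p : Fin n} {d : V} (h : A.HasDecided c p d)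
    (w : List (Fin n)) : A.HasDecided (A.exec c w) p d := by
  induction w generalizing c with
  | nil => exact h
  | cons q w ih =>
    refine ih ?_
    by_cases hpq : p = q
    · subst hpq
      rwa [h.step_eq]
    · unfold HasDecided
      rwa [loc_step_of_ne c hpq]

theorem HasDecided.run_mono {x : Fin n → V} {σ : ℕ → Fin n} {p : Fin n} {d : V} {i j : ℕ}
    (h : A.HasDecided (A.run x σ i) p d) (hij : i ≤ j) : A.HasDecided (A.run x σ j) p d := by
  obtain ⟨l, rfl⟩ := Nat.exists_eq_add_of_le hij
  rw [run_eq_exec] at h ⊢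
  rw [List.range_add, List.map_append, exec_append]
  exact h.exec _

/-! ### Executions that some processes cannot tell apart -/

/-- The configurations `c` and `c'` differ at most in the local states of the processes in `S` and
in the objects in `O`. -/
structure Similar (A : Algorithm.{u, v} n V) (S : Set (Fin n)) (O : Set A.Obj)
    (c c' : A.Config) : Prop where
  loc : ∀ p, p ∉ S → c.loc p = c'.loc p
  reg : c.reg = c'.reg
  obj : ∀ o, o ∉ O → c.obj o = c'.obj o

theorem Similar.mono {S S' : Set (Fin n)} {O : Set A.Obj} {c c' : A.Config}
    (h : A.Similar S O c c') (hS : S ⊆ S') : A.Similar S' O c c' :=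
  ⟨fun p hp => h.loc p fun hpS => hp (hS hpS), h.reg, h.obj⟩

theorem Similar.step {S : Set (Fin n)} {O : Set A.Obj} {c c' : A.Config}
    (h : A.Similar S O c c') {p : Fin n} (hp : p ∉ S) (hO : ∀ o ∈ O, ¬ A.Poised c p o) :
    A.Similar S O (A.step c p) (A.step c' p) := by
  classical
  obtain ⟨hloc, hreg, hobj⟩ := h
  unfold Algorithm.step
  rw [← hloc p hp]
  rcases hact : A.action p (c.loc p) with ⟨r, next⟩ | ⟨r, a, next⟩ | ⟨o, a, next⟩ | d
  · refine ⟨fun q hq => ?_, hreg, hobj⟩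
    by_cases hqp : q = p
    · subst hqp; simp [hreg]
    · simp [hqp, hloc q hq]
  · refine ⟨fun q hq => ?_, by simp [hreg], hobj⟩
    by_cases hqp : q = p
    · subst hqp; simp
    · simp [hqp, hloc q hq]
  · have ho : o ∉ O := fun ho => hO o ho ⟨a, next, hact⟩
    refine ⟨fun q hq => ?_, hreg, fun o' ho' => ?_⟩
    · by_cases hqp : q = p
      · subst hqp; simp [hobj o ho]
      · simp [hqp, hloc q hq]
    · by_cases hoo : o' = o
      · subst hoo; simp [hobj o' ho]
      · simp [hoo, hobj o' ho']
  · exact ⟨hloc, hreg, hobj⟩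

/-- Similar configurations stay similar as long as only processes outside `S` take steps and none
of these steps is a proposal to an object in `O`. -/
theorem Similar.exec_or {S : Set (Fin n)} {O : Set A.Obj} {c c' : A.Config}
    (h : A.Similar S O c c') (w : List (Fin n)) (hw : ∀ p ∈ w, p ∉ S) :
    A.Similar S O (A.exec c w) (A.exec c' w) ∨
      ∃ w₁ p, p ∉ S ∧ A.Similar S O (A.exec c w₁) (A.exec c' w₁) ∧
        ∃ o ∈ O, A.Poised (A.exec c w₁) p o := by
  induction w generalizing c c' with
  | nil => exact Or.inl h
  | cons p w ih =>
    by_cases hO : ∃ o ∈ O, A.Poised c p o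
    · exact Or.inr ⟨[], p, hw p (by simp), h, hO⟩
    · rcases ih (h.step (hw p (by simp)) fun o ho hp => hO ⟨o, ho, hp⟩)
        (fun q hq => hw q (List.mem_cons_of_mem _ hq)) with h' | ⟨w₁, q, h'⟩
      · exact Or.inl h'
      · exact Or.inr ⟨p :: w₁, q, h'⟩

/-! ### Processes that access a common object -/

/-- The processes that, at some point of the execution on inputs `x` with finite schedule `w`,
are about to propose to the object `o`. -/
def poisedSet (A : Algorithm.{u, v} n V) (x : Fin n → V) (w : List (Fin n)) (o : A.Obj) :
    Set (Fin n) :=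
  {p | ∃ w', w' <+: w ∧ A.Poised (A.exec (A.initial x) w') p o}

theorem poisedSet_mono (x : Fin n → V) {w w' : List (Fin n)} (h : w <+: w') (o : A.Obj) :
    A.poisedSet x w o ⊆ A.poisedSet x w' o :=
  fun _ ⟨u, hu, hp⟩ => ⟨u, hu.trans h, hp⟩

/-- A process about to propose to `o` does so when it next takes a step. -/
theorem accesses_of_poised {x : Fin n → V} {σ : ℕ → Fin n} {p : Fin n} {o : A.Obj}
    {i j : ℕ} (hp : A.Poised (A.run x σ i) p o) (hij : i ≤ j) (hj : σ j = p) :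
    A.Accesses x σ p o := by
  induction hij using Nat.decreasingInduction with
  | self => exact ⟨j, hj, hp⟩
  | of_succ l hl ih =>
    by_cases hlp : σ l = p
    · exact ⟨l, hlp, hp⟩
    · refine ih ?_
      unfold Poised
      rwa [run, loc_step_of_ne _ (Ne.symm hlp)]

/-- In an object for `t` processes, at most `t` processes get as far as being about to access
it: let everyone take further steps, and they all access it in the same run. -/
theorem ncard_poisedSet_le {I : Finset V} {t : ℕ} (hn : 0 < n) (hA : A.UsesObjectsFor I t)
    {x : Fin n → V} (hx : ∀ p, x p ∈ I) (w : List (Fin n)) (o : A.Obj) :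
    (A.poisedSet x w o).ncard ≤ t := by
  obtain ⟨σ, hfair, hw⟩ := exists_fair_extension hn w
  refine (Set.ncard_le_ncard ?_ (Set.toFinite _)).trans (hA x hx σ o)
  rintro p ⟨w', ⟨u, rfl⟩, hp⟩
  obtain ⟨i, hi, hσ⟩ := hfair p w'.length
  refine accesses_of_poised (i := w'.length) ?_ hi hσ
  rw [List.length_append, List.range_add, List.map_append] at hw
  rw [run_eq_exec, (List.append_inj hw (by simp)).1]
  exact hp

/-! ### Committed values -/

/-- Outside `S`, more than `n - k` processes have decided on `v` in the configuration `c`; the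
inequality is stated without truncated subtraction. -/
def Commits (A : Algorithm.{u, v} n V) (k : ℕ) (c : A.Config) (S : Set (Fin n)) (v : V) : Prop :=
  n < {p | p ∉ S ∧ A.HasDecided c p v}.ncard + k

theorem Commits.exec {k : ℕ} {c : A.Config} {S : Set (Fin n)} {v : V} (h : A.Commits k c S v)
    (w : List (Fin n)) : A.Commits k (A.exec c w) S v := by
  have hle : {p | p ∉ S ∧ A.HasDecided c p v}.ncard ≤
      {p | p ∉ S ∧ A.HasDecided (A.exec c w) p v}.ncard :=
    Set.ncard_le_ncard (fun p hp => ⟨hp.1, hp.2.exec w⟩) (Set.toFinite _)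
  unfold Commits at h ⊢
  omega

theorem Commits.mono {k : ℕ} {c : A.Config} {S S' : Set (Fin n)} {v : V}
    (h : A.Commits k c S v) (hS : S' ⊆ S) : A.Commits k c S' v := by
  have hle : {p | p ∉ S ∧ A.HasDecided c p v}.ncard ≤
      {p | p ∉ S' ∧ A.HasDecided c p v}.ncard :=
    Set.ncard_le_ncard (fun p hp => ⟨fun hp' => hp.1 (hS hp'), hp.2⟩) (Set.toFinite _)
  unfold Commits at h ⊢
  omega

theorem Similar.commits {k : ℕ} {S : Set (Fin n)} {O : Set A.Obj} {c c' : A.Config}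
    (h : A.Similar S O c c') {v : V} (hc : A.Commits k c S v) : A.Commits k c' S v := by
  have hset : {p | p ∉ S ∧ A.HasDecided c p v} = {p | p ∉ S ∧ A.HasDecided c' p v} := by
    ext p
    refine and_congr_right fun hp => ?_
    unfold HasDecided
    rw [h.loc p hp]
  unfold Commits at hc ⊢
  rwa [← hset]

/-- A committed value is the value on which all but at most `n - k` deciding processes decide. -/
theorem Commits.eq_of_agreement {k : ℕ} {x : Fin n → V} {σ : ℕ → Fin n} {i : ℕ}
    {S : Set (Fin n)} {v d : V} (h : A.Commits k (A.run x σ i) S v)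
    (hd : {p | ∃ e, e ≠ d ∧ A.Decides x σ p e}.ncard + k ≤ n) : v = d := by
  by_contra hne
  have hle : {p | p ∉ S ∧ A.HasDecided (A.run x σ i) p v}.ncard ≤
      {p | ∃ e, e ≠ d ∧ A.Decides x σ p e}.ncard :=
    Set.ncard_le_ncard (fun p hp => ⟨v, hne, i, hp.2⟩) (Set.toFinite _)
  unfold Commits at h
  omega

theorem exists_run_eq (hn : 0 < n) (x : Fin n → V) (w : List (Fin n)) :
    ∃ σ i, A.run x σ i = A.exec (A.initial x) w := by
  obtain ⟨σ, -, hw⟩ := exists_fair_extension hn w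
  exact ⟨σ, w.length, by rw [run_eq_exec, hw]⟩

section Solves

variable {val : Validity} {I : Finset V} {k t : ℕ}

theorem Commits.unique (hn : 0 < n) (hA : A.SolvesPartialAgreement val I k t) {x : Fin n → V}
    (hx : ∀ p, x p ∈ I) {w : List (Fin n)} {S S' : Set (Fin n)} {v v' : V}
    (h : A.Commits k (A.exec (A.initial x) w) S v)
    (h' : A.Commits k (A.exec (A.initial x) w) S' v') : v = v' := by
  obtain ⟨σ, i, hw⟩ := A.exists_run_eq hn x w
  obtain ⟨⟨d, hd, -⟩, -⟩ := hA x hx σ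
  rw [← hw] at h h'
  rw [h.eq_of_agreement hd, h'.eq_of_agreement hd]

theorem Commits.valid (hn : 0 < n) (hA : A.SolvesPartialAgreement val I k t) {x : Fin n → V}
    (hx : ∀ p, x p ∈ I) {w : List (Fin n)} {S : Set (Fin n)} {v : V}
    (h : A.Commits k (A.exec (A.initial x) w) S v) : ∃ q, x q = v := by
  obtain ⟨σ, i, hw⟩ := A.exists_run_eq hn x w
  obtain ⟨⟨d, hd, hval⟩, -⟩ := hA x hx σ
  rw [← hw] at h
  obtain rfl := h.eq_of_agreement hd
  cases val with
  | weak => exact hval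
  | strong =>
    have hpos : 0 < {p | p ∉ S ∧ A.HasDecided (A.run x σ i) p v}.ncard := by
      unfold Commits at h
      omega
    obtain ⟨p, -, hp⟩ := (Set.ncard_pos (Set.toFinite _)).1 hpos
    exact hval p v ⟨i, hp⟩

/-- In a run in which at most the processes of `S` crash, where `S` has at most `t` elements, the
processes outside `S` eventually commit to a value. At least `n - t` of them decide, at most
`n - k` on another value than the common one, and `(n - t) - (n - k) > n - k`. -/
theorem exists_commits_run (hA : A.SolvesPartialAgreement val I k t) (hk : n + t + 1 ≤ 2 * k)
    {x : Fin n → V} (hx : ∀ p, x p ∈ I) {S : Set (Fin n)} (hS : S.ncard ≤ t) {σ : ℕ → Fin n}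
    (hσ : ∀ p, p ∉ S → ¬ Crashes σ p) :
    ∃ v N, ∀ M, N ≤ M → A.Commits k (A.run x σ M) S v := by
  obtain ⟨⟨d, hd, -⟩, hres⟩ := hA x hx σ
  have hcr : {p | Crashes σ p}.ncard ≤ t :=
    (Set.ncard_le_ncard (fun p hp => by_contra fun hpS => hσ p hpS hp) (Set.toFinite _)).trans hS
  have hdec : ∀ p, ∃ i, p ∉ S → ∃ e, A.HasDecided (A.run x σ i) p e := by
    intro p
    by_cases hp : p ∈ S
    · exact ⟨0, fun h => absurd hp h⟩
    · obtain ⟨e, i, hi⟩ := hres hcr p (hσ p hp)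
      exact ⟨i, fun _ => ⟨e, hi⟩⟩
  choose i hi using hdec
  refine ⟨d, Finset.univ.sup i, fun M hM => ?_⟩
  have hcover : Sᶜ ⊆ {p | p ∉ S ∧ A.HasDecided (A.run x σ M) p d} ∪
      {p | ∃ e, e ≠ d ∧ A.Decides x σ p e} := by
    intro p hp
    obtain ⟨e, he⟩ := hi p hp
    have he' := he.run_mono ((Finset.le_sup (Finset.mem_univ p)).trans hM)
    by_cases hed : e = d
    · subst hed
      exact Or.inl ⟨hp, he'⟩
    · exact Or.inr ⟨e, hed, _, he⟩
  have h₁ := (Set.ncard_le_ncard hcover (Set.toFinite _)).trans (Set.ncard_union_le _ _)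
  have h₂ := Set.ncard_add_ncard_compl S
  rw [Nat.card_fin] at h₂
  unfold Commits
  omega

theorem exists_commits (ht : t < n) (hA : A.SolvesPartialAgreement val I k t)
    (hk : n + t + 1 ≤ 2 * k) {x : Fin n → V} (hx : ∀ p, x p ∈ I) {S : Set (Fin n)}
    (hS : S.ncard ≤ t) (w : List (Fin n)) :
    ∃ u v, (∀ p ∈ u, p ∉ S) ∧ A.Commits k (A.exec (A.initial x) (w ++ u)) S v := by
  have hne : (Sᶜ).Nonempty := by
    have h₂ := Set.ncard_add_ncard_compl S
    rw [Nat.card_fin] at h₂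
    exact (Set.ncard_pos (Set.toFinite _)).1 (by omega)
  obtain ⟨σ, hfair, hP, -⟩ := exists_fair_schedule (Set.to_countable Sᶜ) hne
    (fun w' => ∃ u, w' = w ++ u ∧ ∀ p ∈ u, p ∉ S) w ⟨[], by simp⟩ (by
      rintro _ ⟨u, rfl, hu⟩ p hp
      refine ⟨[], u ++ [p], by simp, fun q hq => ?_⟩
      rcases List.mem_append.1 hq with h | h
      · exact hu q h
      · rw [List.mem_singleton.1 h]
        exact hp)
  obtain ⟨v, N, hv⟩ := exists_commits_run hA hk hx hS (σ := σ) (by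
    rintro p hp ⟨N, hN⟩
    obtain ⟨i, hi, hip⟩ := hfair p hp N
    exact hN i hi hip)
  obtain ⟨M, hM, u, hu, huS⟩ := hP N
  refine ⟨u, v, huS, ?_⟩
  rw [← hu, ← run_eq_exec]
  exact hv M hM

/-! ### Valence -/

/-- The value `v` can still become committed from the configuration `c`. -/
def Possible (A : Algorithm.{u, v} n V) (k : ℕ) (c : A.Config) (v : V) : Prop :=
  ∃ u, A.Commits k (A.exec c u) ∅ v

/-- At least two values can still become committed from `c`. -/
def Bivalent (A : Algorithm.{u, v} n V) (k : ℕ) (c : A.Config) : Prop :=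
  ∃ v v', v ≠ v' ∧ A.Possible k c v ∧ A.Possible k c v'

theorem Possible.of_exec {c : A.Config} {w : List (Fin n)} {v : V}
    (h : A.Possible k (A.exec c w) v) : A.Possible k c v := by
  obtain ⟨u, hu⟩ := h
  exact ⟨w ++ u, by rwa [exec_append]⟩

theorem Possible.of_step {c : A.Config} {p : Fin n} {v : V}
    (h : A.Possible k (A.step c p) v) : A.Possible k c v :=
  Possible.of_exec (w := [p]) h

theorem Commits.possible_eq (hn : 0 < n) (hA : A.SolvesPartialAgreement val I k t)
    {x : Fin n → V} (hx : ∀ p, x p ∈ I) {w : List (Fin n)} {S : Set (Fin n)} {v v' : V}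
    (h : A.Commits k (A.exec (A.initial x) w) S v)
    (h' : A.Possible k (A.exec (A.initial x) w) v') : v' = v := by
  obtain ⟨u, hu⟩ := h'
  have h := h.exec u
  rw [← exec_append] at h hu
  exact hu.unique hn hA hx h

/-- If `S` has at most `t` elements and two configurations differ only in the local states of the
processes in `S`, then some value is possible in both. -/
theorem exists_possible_of_similar (ht : t < n) (hA : A.SolvesPartialAgreement val I k t)
    (hk : n + t + 1 ≤ 2 * k) {x : Fin n → V} (hx : ∀ p, x p ∈ I) {S : Set (Fin n)}
    (hS : S.ncard ≤ t) {w : List (Fin n)} {c : A.Config}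
    (h : A.Similar S ∅ (A.exec (A.initial x) w) c) :
    ∃ v, A.Possible k (A.exec (A.initial x) w) v ∧ A.Possible k c v := by
  obtain ⟨u, v, hu, hv⟩ := exists_commits ht hA hk hx hS w
  rw [exec_append] at hv
  rcases h.exec_or u hu with h' | ⟨_, _, _, _, _, ho, _⟩
  · exact ⟨v, ⟨u, hv.mono (Set.empty_subset _)⟩, u, (h'.commits hv).mono (Set.empty_subset _)⟩
  · exact absurd ho (Set.notMem_empty _)

/-- The configurations may also differ in one object `o` for `t` processes, if every process in `S`
has been about to access `o`. Halt each process that comes to be about to access `o`: no more than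
`t` processes are ever halted, so the others commit to a value, and they never learn in which of
the two configurations they started. -/
theorem exists_possible_of_similar_of_poised (ht : t < n) (hU : A.UsesObjectsFor I t)
    (hA : A.SolvesPartialAgreement val I k t)
    (hk : n + t + 1 ≤ 2 * k) {x : Fin n → V} (hx : ∀ p, x p ∈ I) {o : A.Obj} {S : Set (Fin n)}
    {w : List (Fin n)} (hS : S ⊆ A.poisedSet x w o) {c : A.Config}
    (h : A.Similar S {o} (A.exec (A.initial x) w) c) :
    ∃ v, A.Possible k (A.exec (A.initial x) w) v ∧ A.Possible k c v := by
  induction hm : n - S.ncard using Nat.strong_induction_on generalizing S w c with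
  | _ m ih =>
    have hSt : S.ncard ≤ t := (Set.ncard_le_ncard hS (Set.toFinite _)).trans
      (ncard_poisedSet_le (by omega) hU hx w o)
    obtain ⟨u, v, hu, hv⟩ := exists_commits ht hA hk hx hSt w
    rw [exec_append] at hv
    rcases h.exec_or u hu with h' | ⟨u₁, r, hr, h', _, rfl, hpo⟩
    · exact ⟨v, ⟨u, hv.mono (Set.empty_subset _)⟩, u,
        (h'.commits hv).mono (Set.empty_subset _)⟩
    · rw [← exec_append] at h' hpo
      have hcard : (insert r S).ncard = S.ncard + 1 :=
        Set.ncard_insert_of_notMem hr (Set.toFinite _)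
      obtain ⟨v', hv₁, hv₂⟩ := ih (n - (insert r S).ncard) (by omega)
        (Set.insert_subset ⟨_, List.prefix_rfl, hpo⟩
          (hS.trans (poisedSet_mono x (List.prefix_append _ _) _)))
        (h'.mono (Set.subset_insert r S)) rfl
      rw [exec_append] at hv₁
      exact ⟨v', hv₁.of_exec, hv₂.of_exec⟩

/-- Some initial configuration is bivalent: change the inputs from all `a` to all `b` one at a
time. The configurations before and after a change differ in the local state of one process only,
so they share a possible value. -/
theorem exists_bivalent_initial (ht₁ : 1 ≤ t) (ht : t < n)
    (hA : A.SolvesPartialAgreement val I k t) (hk : n + t + 1 ≤ 2 * k) {a b : V} (hab : a ≠ b)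
    (ha : a ∈ I) (hb : b ∈ I) : ∃ x, (∀ p, x p ∈ I) ∧ A.Bivalent k (A.initial x) := by
  by_contra! hcon
  let x : ℕ → Fin n → V := fun j p => if p.1 < j then b else a
  have hx : ∀ j p, x j p ∈ I := by
    intro j p
    by_cases h : p.1 < j <;> simp [x, h, ha, hb]
  have key : ∀ j, j ≤ n → A.Possible k (A.initial (x j)) a := by
    intro j
    induction j with
    | zero =>
      intro _
      obtain ⟨u, v, -, hv⟩ := exists_commits ht hA hk (hx 0) (S := ∅) (by simp) []
      obtain ⟨q, hq⟩ := hv.valid (by omega) hA (hx 0)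
      have hva : a = v := by simpa [x] using hq
      subst hva
      exact ⟨u, by simpa using hv⟩
    | succ j ih =>
      intro hj
      have hsim : A.Similar {⟨j, hj⟩} ∅ (A.exec (A.initial (x j)) []) (A.initial (x (j + 1))) := by
        refine ⟨fun p hp => ?_, rfl, fun _ _ => rfl⟩
        have hpj : p.1 ≠ j := fun h => hp (Fin.ext h)
        have hiff : p.1 < j ↔ p.1 < j + 1 := by omega
        simp [Algorithm.initial, x, hiff]
      obtain ⟨v, hv₁, hv₂⟩ := exists_possible_of_similar ht hA hk (hx j) (by simpa using ht₁) hsim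
      have hva : v = a := by
        by_contra hne
        exact hcon _ (hx j) ⟨v, a, hne, hv₁, ih (by omega)⟩
      rwa [← hva]
  obtain ⟨u, hu⟩ := key n le_rfl
  obtain ⟨q, hq⟩ := hu.valid (by omega) hA (hx n)
  exact hab (by simpa [x] using hq.symm)

/-- A bivalent configuration cannot stay bivalent forever while all processes take steps, so there
is a bivalent configuration, and a process `p`, such that every later step of `p` ends bivalence. -/
theorem exists_critical (ht : t < n) (hA : A.SolvesPartialAgreement val I k t)
    (hk : n + t + 1 ≤ 2 * k) {x : Fin n → V} (hx : ∀ p, x p ∈ I)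
    (hbi : A.Bivalent k (A.initial x)) :
    ∃ w p, A.Bivalent k (A.exec (A.initial x) w) ∧
      ∀ u, ¬ A.Bivalent k (A.exec (A.initial x) (w ++ u ++ [p])) := by
  by_contra! hcon
  obtain ⟨σ, hfair, hP, -⟩ := exists_fair_schedule (T := (Set.univ : Set (Fin n)))
    (Set.to_countable _) ⟨⟨0, by omega⟩, trivial⟩
    (fun w => A.Bivalent k (A.exec (A.initial x) w)) [] hbi (fun w hw p _ => hcon w p hw)
  obtain ⟨v, N, hv⟩ := exists_commits_run hA hk hx (S := ∅) (σ := σ) (by simp) (by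
    rintro p - ⟨N, hN⟩
    obtain ⟨i, hi, hip⟩ := hfair p trivial N
    exact hN i hi hip)
  obtain ⟨M, hM, d, e, hde, hd, he⟩ := hP N
  have hM := hv M hM
  rw [run_eq_exec] at hM
  have hn : 0 < n := by omega
  exact hde ((hM.possible_eq hn hA hx hd).trans (hM.possible_eq hn hA hx he).symm)

/-- Next to a bivalent configuration whose bivalence every step of `p` ends there are two
successive configurations, joined by a step of `q`, in which a step of `p` leads to configurations
without a common possible value. -/
theorem exists_fork (ht : t < n) (hA : A.SolvesPartialAgreement val I k t)
    (hk : n + t + 1 ≤ 2 * k) {x : Fin n → V} (hx : ∀ p, x p ∈ I) {w : List (Fin n)} {p : Fin n}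
    (hbi : A.Bivalent k (A.exec (A.initial x) w))
    (hp : ∀ u, ¬ A.Bivalent k (A.exec (A.initial x) (w ++ u ++ [p]))) :
    ∃ w' q, ∀ v, A.Possible k (A.exec (A.initial x) (w' ++ [p])) v →
      ¬ A.Possible k (A.exec (A.initial x) (w' ++ [q, p])) v := by
  by_contra! hcon
  have hn : 0 < n := by omega
  have hone : ∀ u v v', A.Possible k (A.exec (A.initial x) (w ++ u ++ [p])) v →
      A.Possible k (A.exec (A.initial x) (w ++ u ++ [p])) v' → v = v' := by
    intro u v v' hv hv'
    by_contra hne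
    exact hp u ⟨v, v', hne, hv, hv'⟩
  obtain ⟨v, hv⟩ : ∃ v, A.Possible k (A.exec (A.initial x) (w ++ [p])) v := by
    obtain ⟨u, v, -, hv⟩ := exists_commits ht hA hk hx (S := ∅) (by simp) (w ++ [p])
    rw [exec_append] at hv
    exact ⟨v, u, hv⟩
  -- Without such a fork, `v` stays possible after a later step of `p`, whatever happens before.
  have key : ∀ u, A.Possible k (A.exec (A.initial x) (w ++ u ++ [p])) v := by
    intro u
    induction u using List.reverseRecOn with
    | nil => simpa using hv
    | append_singleton u q ih =>
      obtain ⟨v', h₁, h₂⟩ := hcon (w ++ u) q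
      rw [hone u v v' ih h₁]
      simpa using h₂
  have hall : ∀ v', A.Possible k (A.exec (A.initial x) w) v' → v' = v := by
    rintro v' ⟨u, hu⟩
    rw [← exec_append] at hu
    have h := key u
    rw [exec_append] at h
    exact (hu.possible_eq hn hA hx h.of_exec).symm
  obtain ⟨d, e, hde, hd, he⟩ := hbi
  exact hde ((hall d hd).trans (hall e he).symm)

end Solves

/-! ### The impossibility argument -/

/-- How the steps of two processes interact: they commute; or one process has only read, or has
its write overwritten, so that nobody else notices whether or when it took its step; or both
processes propose to the same object. -/
theorem step_interaction (c : A.Config) {p q : Fin n} (hpq : p ≠ q) :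
    A.step (A.step c q) p = A.step (A.step c p) q ∨
      A.Similar {q} ∅ (A.step c p) (A.step (A.step c q) p) ∨
      A.Similar {p} ∅ (A.step (A.step c p) q) (A.step (A.step c q) p) ∨
      ∃ o, A.Poised c p o ∧ A.Poised c q o ∧
        A.Similar {p, q} {o} (A.step c p) (A.step (A.step c q) p) := by
  classical
  have hqp : q ≠ p := hpq.symm
  have hlp : (A.step c q).loc p = c.loc p := loc_step_of_ne c hpq
  have hlq : (A.step c p).loc q = c.loc q := loc_step_of_ne c hqp
  rcases hq : A.action q (c.loc q) with ⟨r, f⟩ | ⟨r, a, f⟩ | ⟨o, a, f⟩ | d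
  · have h : A.Similar {q} ∅ c (A.step c q) := by
      unfold step
      rw [hq]
      exact ⟨fun s hs => by simp [Set.mem_singleton_iff.not.1 hs], rfl, fun _ _ => rfl⟩
    exact Or.inr (Or.inl (h.step hpq (by simp)))
  · rcases hp : A.action p (c.loc p) with ⟨r', f'⟩ | ⟨r', a', f'⟩ | ⟨o', a', f'⟩ | d
    · have h : A.Similar {p} ∅ (A.step c p) c := by
        unfold step
        rw [hp]
        exact ⟨fun s hs => by simp [Set.mem_singleton_iff.not.1 hs], rfl, fun _ _ => rfl⟩
      refine Or.inr (Or.inr (Or.inl ?_))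
      have h₁ := h.step (p := q) hqp (by simp)
      refine ⟨fun s hs => ?_, ?_, fun o ho => ?_⟩
      · rw [h₁.loc s hs, loc_step_of_ne _ hs]
      · rw [h₁.reg, step.eq_1 A (A.step c q), hlp, hp]
      · rw [h₁.obj o ho, step.eq_1 A (A.step c q), hlp, hp]
    · by_cases hr : r = r'
      · subst hr
        refine Or.inr (Or.inl ⟨fun s hs => ?_, ?_, fun o _ => ?_⟩)
        · have hs : s ≠ q := hs
          by_cases hsp : s = p
          · subst hsp
            simp [step, hp, hq, hpq]
          · rw [loc_step_of_ne _ hsp, loc_step_of_ne _ hsp, loc_step_of_ne _ hs]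
        · simp [step, hp, hq, hpq]
        · simp [step, hp, hq, hpq]
      · left
        simp [step, hp, hq, hpq, hqp, Function.update_comm hqp, Function.update_comm hr]
    · left
      simp [step, hp, hq, hpq, hqp, Function.update_comm hqp]
    · left
      have hd : A.HasDecided c p d := hp
      rw [hd.step_eq, HasDecided.step_eq (d := d) (by unfold HasDecided; rw [hlp, hp])]
  · rcases hp : A.action p (c.loc p) with ⟨r', f'⟩ | ⟨r', a', f'⟩ | ⟨o', a', f'⟩ | d
    · left
      simp [step, hp, hq, hpq, hqp, Function.update_comm hqp]
    · left
      simp [step, hp, hq, hpq, hqp, Function.update_comm hqp]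
    · by_cases ho : o = o'
      · subst ho
        refine Or.inr (Or.inr (Or.inr ⟨o, ⟨_, _, hp⟩, ⟨_, _, hq⟩, ⟨fun s hs => ?_, ?_,
          fun o₁ ho₁ => ?_⟩⟩))
        · simp only [Set.mem_insert_iff, Set.mem_singleton_iff, not_or] at hs
          rw [loc_step_of_ne _ hs.1, loc_step_of_ne _ hs.1, loc_step_of_ne _ hs.2]
        · simp [step, hp, hq, hpq]
        · have ho₁ : o₁ ≠ o := ho₁
          simp [step, hp, hq, hpq, ho₁]
      · left
        simp [step, hp, hq, hpq, hqp, Function.update_comm hqp, Function.update_comm ho, ho,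
          Ne.symm ho]
    · left
      have hd : A.HasDecided c p d := hp
      rw [hd.step_eq, HasDecided.step_eq (d := d) (by unfold HasDecided; rw [hlp, hp])]
  · left
    have hd : A.HasDecided c q d := hq
    have hd' : A.HasDecided (A.step c p) q d := by
      unfold HasDecided
      rw [hlq, hq]
    rw [hd.step_eq, hd'.step_eq]

/-- A step of `q` cannot separate the values that are possible after a step of `p`. -/
theorem exists_possible_step_step {val : Validity} {I : Finset V} {k t : ℕ} (ht₁ : 1 ≤ t)
    (ht : t < n) (hU : A.UsesObjectsFor I t) (hA : A.SolvesPartialAgreement val I k t)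
    (hk : n + t + 1 ≤ 2 * k) {x : Fin n → V} (hx : ∀ p, x p ∈ I) (w : List (Fin n))
    (p q : Fin n) :
    ∃ v, A.Possible k (A.exec (A.initial x) (w ++ [p])) v ∧
      A.Possible k (A.exec (A.initial x) (w ++ [q, p])) v := by
  have hex : ∀ w', ∃ v, A.Possible k (A.exec (A.initial x) w') v := by
    intro w'
    obtain ⟨u, v, -, hv⟩ := exists_commits ht hA hk hx (S := ∅) (by simp) w'
    rw [exec_append] at hv
    exact ⟨v, u, hv⟩
  by_cases hpq : p = q
  · subst hpq
    obtain ⟨v, hv⟩ := hex (w ++ [p, p])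
    exact ⟨v, Possible.of_step (p := p) (by simpa using hv), hv⟩
  have hsingle : ∀ r : Fin n, ({r} : Set (Fin n)).ncard ≤ t := fun r => by simpa using ht₁
  rcases step_interaction (A.exec (A.initial x) w) hpq with h | h | h | ⟨o, hp, hq, h⟩
  · obtain ⟨v, hv⟩ := hex (w ++ [q, p])
    refine ⟨v, Possible.of_step (p := q) ?_, hv⟩
    simp only [exec_append, exec_cons, exec_nil] at hv ⊢
    rwa [← h]
  · obtain ⟨v, hv₁, hv₂⟩ := exists_possible_of_similar ht hA hk hx (hsingle q)
      (w := w ++ [p]) (by simpa using h)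
    exact ⟨v, hv₁, by simpa using hv₂⟩
  · obtain ⟨v, hv₁, hv₂⟩ := exists_possible_of_similar ht hA hk hx (hsingle p)
      (w := w ++ [p, q]) (by simpa using h)
    exact ⟨v, Possible.of_step (p := q) (by simpa using hv₁), by simpa using hv₂⟩
  · have hS : {p, q} ⊆ A.poisedSet x (w ++ [p]) o := by
      rintro r (rfl | rfl)
      · exact ⟨w, List.prefix_append _ _, hp⟩
      · exact ⟨w, List.prefix_append _ _, hq⟩
    obtain ⟨v, hv₁, hv₂⟩ := exists_possible_of_similar_of_poised ht hU hA hk hx hS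
      (by simpa using h)
    exact ⟨v, hv₁, by simpa using hv₂⟩

/-- With objects for `t` processes, no algorithm that tolerates `t` crash failures makes `k`
processes agree when `2 k > n + t`. -/
theorem two_mul_le_of_solves {val : Validity} {I : Finset V} {k t : ℕ} (ht₁ : 1 ≤ t)
    (ht : t < n) (hI : 1 < I.card) (hU : A.UsesObjectsFor I t)
    (hA : A.SolvesPartialAgreement val I k t) : 2 * k ≤ n + t := by
  by_contra! hk
  obtain ⟨a, ha, b, hb, hab⟩ := Finset.one_lt_card.1 hI
  obtain ⟨x, hx, hbi⟩ := exists_bivalent_initial ht₁ ht hA hk hab ha hb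
  obtain ⟨w, p, hw, hp⟩ := exists_critical ht hA hk hx hbi
  obtain ⟨w', q, hq⟩ := exists_fork ht hA hk hx hw hp
  obtain ⟨v, h₁, h₂⟩ := exists_possible_step_step ht₁ ht hU hA hk hx w' p q
  exact hq v h₁ h₂

end Algorithm

end PartialAgreement

theorem theorem5 {V : Type u} (n m t k : ℕ) (hm : 2 ≤ m) (ht : 1 ≤ t) (htn : t < n)
    (I : Finset V) (hI : I.card = m) (val : PartialAgreement.Validity) :
    (∃ A : PartialAgreement.Algorithm.{u, v} n V,
      A.UsesObjectsFor I t ∧ A.SolvesPartialAgreement val I k t) →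
    (k : ℤ) ≤ ⌈((n : ℚ) + (t : ℚ) - 1) / 2⌉ := by
  rintro ⟨A, hU, hA⟩
  have h : 2 * k ≤ n + t := A.two_mul_le_of_solves ht htn (by omega) hU hA
  have hle := Int.le_ceil (((n : ℚ) + (t : ℚ) - 1) / 2)
  -- `2 ⌈(n + t - 1) / 2⌉ ≥ n + t - 1` falls one short of the bound; parity makes up for it.
  have hZ : (n : ℤ) + t - 1 ≤ 2 * ⌈((n : ℚ) + (t : ℚ) - 1) / 2⌉ := by
    have hQ : (n : ℚ) + t - 1 ≤ 2 * (⌈((n : ℚ) + (t : ℚ) - 1) / 2⌉ : ℚ) := by linarith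
    exact_mod_cast hQ
  omega
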